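/- Let $G$ be a finite connected simple graph on at least three vertices. Write $d(v)$ for the degree and $N(v)$ for the set of neighbours of a vertex $v$, and $d(u,v)$ for the distance between $u$ and $v$. Suppose that $G$ is an $L_1$-graph, that is, $$d(u)+d(v)\ge |N(u)\cup N(v)\cup N(w)|-1$$ for all vertices $u,v,w$ with $d(u,v)=2$ and $w\in N(u)\cap N(v)$, and that $|N(u)\cap N(v)|\ge 2$ for each pair of vertices $u,v$ with $d(u,v)=2$. Let $\mathcal{K}$ be the family of all graphs $H$ such that $K_{p,p+1}\subseteq H\subseteq K_p\vee\overline{K_{p+1}}$ for some $p\ge 2$, where $\vee$ denotes the join. Then for every pair of vertices $x,y\in V(G)$ with $N(x)\cap N(y)=\emptyset$ there are an integer $r\ge 1$, integers $n_1,n_2,\dots,n_r$ and $x$–$y$ paths $P_{n_1},P_{n_2},\dots,P_{n_r}$ in $G$ with $n_1,n_2,\dots,n_r$ vertices, respectively, such that - $n_1=d(x,y)+1$; - $n_r=|V(G)|$ if $G\notin\mathcal{K}$, and $n_r=|V(G)|-1$ if $G\in\mathcal{K}$; - $1\le n_{i+1}-n_i\le 2$ for each $i=1,\dots,r-1$; -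 $V(P_{n_1})\subset V(P_{n_2})\subset\dots\subset V(P_{n_r})$, with strict inclusions. -/

import Mathlib

namespace SimpleGraph

/-- The join `G ∨ H`: the disjoint union of `G` and `H` together with all edges between them. -/
def joinGraph {V W : Type*} (G : SimpleGraph V) (H : SimpleGraph W) : SimpleGraph (V ⊕ W) :=
  (G ⊕g H) ⊔ completeBipartiteGraph V W

/-- `G` is an `L_i`-graph: `d(u) + d(v) ≥ |N(u) ∪ N(v) ∪ N(w)| - i` for all vertices `u, v, w` with
`d(u, v) = 2` and `w ∈ N(u) ∩ N(v)`. The term `i` is moved to the other side, to avoid truncated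
subtraction. -/
def IsLGraph {V : Type*} [DecidableEq V] (i : ℕ) (G : SimpleGraph V) [G.LocallyFinite] : Prop :=
  ∀ u v w : V, G.dist u v = 2 → w ∈ G.neighborFinset u ∩ G.neighborFinset v →
    (G.neighborFinset u ∪ G.neighborFinset v ∪ G.neighborFinset w).card
      ≤ G.degree u + G.degree v + i

/-- Membership in the family `𝒦` of all graphs `G` with `K_{p,p+1} ⊆ G ⊆ K_p ∨ (K_{p+1})ᶜ` for some
`p ≥ 2`. All three graphs have `2p + 1` vertices, so the vertices of `G` are identified with those
of the other two by a bijection `e`. -/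
def MemFamilyK {V : Type*} (G : SimpleGraph V) : Prop :=
  ∃ p : ℕ, 2 ≤ p ∧ ∃ e : V ≃ Fin p ⊕ Fin (p + 1),
    (completeBipartiteGraph (Fin p) (Fin (p + 1))).comap e ≤ G ∧
      G ≤ (joinGraph (completeGraph (Fin p)) (completeGraph (Fin (p + 1)))ᶜ).comap e

end SimpleGraph

/-! Starting from a shortest `x`–`y` path, the vertex set is enlarged by one or two vertices at a
time. Suppose the path `p` misses a neighbour `v` of one of its vertices, `U` is its vertex set
together with `v`, and no path has vertex set `U` or `U` plus one vertex (`Unreached`). As `x` and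
`y` have no common neighbour, `v` is not adjacent to `y`, up to reversal, so every neighbour of `v`
on the path (a contact) has a successor. Insertions and rotations show that `v` and these successors
are independent, and that no two of them share a neighbour outside `U`.

The `L₁`-condition says `|N(w) \ (N(u) ∪ N(v))| ≤ |N(u) ∩ N(v)| + 1`. Take `v`, a successor `p (i +
1)` and a common neighbour `p j`. In the bipartite graph of successors (rows) and contacts
(columns), this bounds column `j` by row `i` for every edge. Double counting
(`card_column_eq_card_row`) turns all these bounds into equalities, which restricts the neighbours
of `p j` (`coverage`).

Hence the contacts are the even positions up to some `M` (`exists_contacts`), contacts and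
successors are completely joined (`complete`), the path ends at `M + 1` (`length_eq`), and
connectedness gives `U = V` and `G ∈ 𝒦` (`eq_univ_and_memFamilyK`). Conversely, a count of
independent vertices rules out a Hamilton path in `𝒦` (`MemFamilyK.support_ne_univ`). -/

namespace SimpleGraph

/-! ### Paths as vertex sets; insertions and rotations. -/

section

variable {V : Type*} [DecidableEq V] {G : SimpleGraph V}

/-- `s` is the vertex set of some path from `a` to `b`. -/
def HasPathOn (G : SimpleGraph V) (a b : V) (s : Finset V) : Prop :=
  ∃ p : G.Walk a b, p.IsPath ∧ p.support.toFinset = s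

theorem hasPathOn_singleton (a : V) : G.HasPathOn a a {a} :=
  ⟨Walk.nil, Walk.IsPath.nil, by simp⟩

theorem HasPathOn.reverse {a b : V} {s : Finset V} (h : G.HasPathOn a b s) :
    G.HasPathOn b a s := by
  obtain ⟨p, hp, rfl⟩ := h
  exact ⟨p.reverse, hp.reverse, by simp⟩

theorem HasPathOn.glue {a b c d : V} {s t : Finset V} (h : G.HasPathOn a b s)
    (hbc : G.Adj b c) (h' : G.HasPathOn c d t) (hst : Disjoint s t) :
    G.HasPathOn a d (s ∪ t) := by
  obtain ⟨p, hp, rfl⟩ := h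
  obtain ⟨q, hq, rfl⟩ := h'
  refine ⟨p.append (Walk.cons hbc q), ?_, ?_⟩
  · rw [Walk.isPath_def, Walk.support_append, Walk.support_cons, List.tail_cons,
      List.nodup_append']
    refine ⟨hp.support_nodup, hq.support_nodup, ?_⟩
    intro z hz hz'
    exact Finset.disjoint_left.1 hst (List.mem_toFinset.2 hz) (List.mem_toFinset.2 hz')
  · rw [Walk.support_append, Walk.support_cons, List.tail_cons, List.toFinset_append]

theorem hasPathOn_image_Icc {p : ℕ → V} {m : ℕ}
    (inj : ∀ i ≤ m, ∀ j ≤ m, p i = p j → i = j) (adj : ∀ i < m, G.Adj (p i) (p (i + 1)))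
    {i j : ℕ} (hij : i ≤ j) (hj : j ≤ m) :
    G.HasPathOn (p i) (p j) ((Finset.Icc i j).image p) := by
  induction j, hij using Nat.le_induction with
  | base => simpa using hasPathOn_singleton (p i)
  | succ j hij ih =>
    have := (ih (by omega)).glue (adj j (by omega)) (hasPathOn_singleton (p (j + 1))) (by
      rw [Finset.disjoint_singleton_right]
      intro h
      obtain ⟨t, ht, h⟩ := Finset.mem_image.1 h
      have := Finset.mem_Icc.1 ht
      have := inj t (by omega) (j + 1) hj h
      omega)
    convert this using 1
    rw [← Finset.insert_Icc_right_eq_Icc_add_one (by omega), Finset.image_insert]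
    ext; simp

/-- No path from `x` to `y` has vertex set `U`, or `U` together with one more vertex. -/
def Unreached (G : SimpleGraph V) (x y : V) (U : Finset V) : Prop :=
  ¬ G.HasPathOn x y U ∧ ∀ q ∉ U, ¬ G.HasPathOn x y (insert q U)

theorem Unreached.symm {x y : V} {U : Finset V} (h : G.Unreached x y U) : G.Unreached y x U :=
  ⟨fun h' => h.1 h'.reverse, fun q hq h' => h.2 q hq h'.reverse⟩

/-- The sequence `p 0, …, p m` is a path from `x` to `y` through all vertices of `U` but `v`. -/
structure PathMissing (G : SimpleGraph V) (x y : V) (U : Finset V) (p : ℕ → V) (m : ℕ) (v : V) :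
    Prop where
  start : p 0 = x
  finish : p m = y
  inj : ∀ i ≤ m, ∀ j ≤ m, p i = p j → i = j
  adj : ∀ i < m, G.Adj (p i) (p (i + 1))
  ne : ∀ i ≤ m, p i ≠ v
  mem_iff : ∀ q, q ∈ U ↔ q = v ∨ ∃ i ≤ m, p i = q

namespace PathMissing

variable {x y v : V} {U : Finset V} {p : ℕ → V} {m : ℕ}

omit [DecidableEq V] in
theorem reverse (h : G.PathMissing x y U p m v) :
    G.PathMissing y x U (fun i => p (m - i)) m v where
  start := by simpa using h.finish
  finish := by simpa using h.start
  inj i hi j hj hij := by have := h.inj _ (by omega) _ (by omega) hij; omega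
  adj i hi := by
    have := h.adj (m - (i + 1)) (by omega)
    rw [show m - (i + 1) + 1 = m - i by omega] at this
    exact this.symm
  ne i hi := h.ne _ (by omega)
  mem_iff q := by
    rw [h.mem_iff]
    refine or_congr_right ⟨?_, ?_⟩
    · rintro ⟨i, hi, rfl⟩
      exact ⟨m - i, by omega, by congr 1; omega⟩
    · rintro ⟨i, hi, rfl⟩
      exact ⟨m - i, by omega, rfl⟩

theorem segment (h : G.PathMissing x y U p m v) {i j : ℕ} (hij : i ≤ j) (hj : j ≤ m) :
    G.HasPathOn (p i) (p j) ((Finset.Icc i j).image p) :=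
  hasPathOn_image_Icc h.inj h.adj hij hj

theorem disjoint_segments (h : G.PathMissing x y U p m v) {i j k l : ℕ} (hj : j ≤ m) (hl : l ≤ m)
    (hd : j < k ∨ l < i) :
    Disjoint ((Finset.Icc i j).image p) ((Finset.Icc k l).image p) := by
  rw [Finset.disjoint_left]
  intro q hq hq'
  obtain ⟨a, ha, rfl⟩ := Finset.mem_image.1 hq
  obtain ⟨b, hb, hab⟩ := Finset.mem_image.1 hq'
  rw [Finset.mem_Icc] at ha hb
  have := h.inj _ (by omega) _ (by omega) hab
  omega

omit [DecidableEq V] in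
theorem mem_of_le (h : G.PathMissing x y U p m v) {i : ℕ} (hi : i ≤ m) : p i ∈ U :=
  (h.mem_iff _).2 (Or.inr ⟨i, hi, rfl⟩)

omit [DecidableEq V] in
theorem missing_mem (h : G.PathMissing x y U p m v) : v ∈ U := (h.mem_iff v).2 (Or.inl rfl)

theorem disjoint_segment (h : G.PathMissing x y U p m v) {i j : ℕ} (hj : j ≤ m) {s : Finset V}
    (hs : ∀ q ∈ s, q = v ∨ q ∉ U) : Disjoint ((Finset.Icc i j).image p) s := by
  rw [Finset.disjoint_left]
  intro q hq hq'
  obtain ⟨a, ha, rfl⟩ := Finset.mem_image.1 hq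
  rw [Finset.mem_Icc] at ha
  rcases hs _ hq' with h' | h'
  · exact h.ne a (by omega) h'
  · exact h' (h.mem_of_le (by omega))

/-- Route the path through a detour between two consecutive vertices. -/
theorem insert_detour (h : G.PathMissing x y U p m v) {i : ℕ} (hi : i < m) {a b : V}
    {s : Finset V} (hs : ∀ q ∈ s, q = v ∨ q ∉ U) (hab : G.HasPathOn a b s)
    (ha : G.Adj (p i) a) (hb : G.Adj b (p (i + 1))) :
    G.HasPathOn x y (U.erase v ∪ s) := by
  have h1 := ((h.segment (Nat.zero_le i) hi.le).glue ha hab (h.disjoint_segment hi.le hs)).glue hb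
    (h.segment (show i + 1 ≤ m from hi) le_rfl) (by
      rw [Finset.disjoint_union_left]
      exact ⟨h.disjoint_segments hi.le le_rfl (by omega), (h.disjoint_segment le_rfl hs).symm⟩)
  rw [h.start, h.finish] at h1
  convert h1 using 1
  ext q
  simp only [Finset.mem_union, Finset.mem_erase, h.mem_iff, Finset.mem_image, Finset.mem_Icc]
  constructor
  · rintro (⟨hq, hq' | ⟨t, ht, rfl⟩⟩ | hq)
    · exact absurd hq' hq
    · rcases le_or_gt t i with hti | hti
      · exact Or.inl (Or.inl ⟨t, by omega, rfl⟩)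
      · exact Or.inr ⟨t, by omega, rfl⟩
    · exact Or.inl (Or.inr hq)
  · rintro ((⟨t, ht, rfl⟩ | hq) | ⟨t, ht, rfl⟩)
    · exact Or.inl ⟨h.ne t (by omega), Or.inr ⟨t, by omega, rfl⟩⟩
    · exact Or.inr hq
    · exact Or.inl ⟨h.ne t (by omega), Or.inr ⟨t, by omega, rfl⟩⟩

theorem not_adj_succ (h : G.PathMissing x y U p m v) (hU : G.Unreached x y U) {i : ℕ} (hi : i < m)
    (h1 : G.Adj v (p i)) : ¬ G.Adj v (p (i + 1)) := by
  intro h2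
  have := h.insert_detour hi (s := {v}) (by simp) (hasPathOn_singleton v) h1.symm h2
  refine hU.1 ?_
  convert this using 1
  rw [Finset.union_comm, ← Finset.insert_eq, Finset.insert_erase h.missing_mem]

theorem not_adj_of_notMem (h : G.PathMissing x y U p m v) (hU : G.Unreached x y U) {i : ℕ}
    (hi : i < m) (h1 : G.Adj v (p i)) {q : V} (hq : q ∉ U) (hvq : G.Adj v q) :
    ¬ G.Adj (p (i + 1)) q := by
  intro h2
  have := h.insert_detour hi (s := {v} ∪ {q}) (by simp [hq])
    ((hasPathOn_singleton v).glue hvq (hasPathOn_singleton q) (by simpa using hvq.ne))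
    h1.symm h2.symm
  refine hU.2 q hq ?_
  convert this using 1
  ext z
  by_cases hz : z = v <;> simp [hz, h.missing_mem, or_comm]

/-- The rotation `p 0, …, p i, v, p j, …, p (i + 1), a, …, b, p (j + 1), …, p m`. -/
theorem rotate (h : G.PathMissing x y U p m v) {i j : ℕ} (hij : i < j) (hj : j < m)
    (hi1 : G.Adj v (p i)) (hj1 : G.Adj v (p j)) {z : V} {s : Finset V}
    (hz : G.HasPathOn z y (s ∪ (Finset.Icc (j + 1) m).image p))
    (hiz : G.Adj (p (i + 1)) z) (hs : ∀ q ∈ s, q ∉ U) :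
    G.HasPathOn x y (U ∪ s) := by
  have h1 := ((((h.segment (Nat.zero_le i) (by omega)).glue hi1.symm (hasPathOn_singleton v)
    (h.disjoint_segment (by omega) (by simp))).glue hj1
    (h.segment (i := i + 1) (j := j) hij hj.le).reverse (by
      rw [Finset.disjoint_union_left]
      exact ⟨h.disjoint_segments (by omega) hj.le (by omega),
        (h.disjoint_segment (by omega) (by simp)).symm⟩)).glue hiz hz (by
      simp only [Finset.disjoint_union_left, Finset.disjoint_union_right]
      have hs' : ∀ q ∈ s, q = v ∨ q ∉ U := fun q hq => Or.inr (hs q hq)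
      refine ⟨⟨⟨h.disjoint_segment (by omega) hs', ?_⟩, h.disjoint_segment (by omega) hs'⟩,
        ⟨h.disjoint_segments (by omega) le_rfl (by omega), ?_⟩,
        h.disjoint_segments (by omega) le_rfl (by omega)⟩
      · rw [Finset.disjoint_singleton_left]
        exact fun hv => hs v hv h.missing_mem
      · exact (h.disjoint_segment (by omega) (by simp)).symm))
  rw [h.start] at h1
  convert h1 using 1
  ext q
  simp only [Finset.mem_union, h.mem_iff, Finset.mem_image, Finset.mem_Icc, Finset.mem_singleton]
  constructor
  · rintro ((hq | ⟨t, ht, rfl⟩) | hq)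
    · exact Or.inl (Or.inl (Or.inr hq))
    · rcases le_or_gt t i with hti | hti
      · exact Or.inl (Or.inl (Or.inl ⟨t, by omega, rfl⟩))
      · rcases le_or_gt t j with htj | htj
        · exact Or.inl (Or.inr ⟨t, by omega, rfl⟩)
        · exact Or.inr (Or.inr ⟨t, by omega, rfl⟩)
    · exact Or.inr (Or.inl hq)
  · rintro (((⟨t, ht, rfl⟩ | hq) | ⟨t, ht, rfl⟩) | hq | ⟨t, ht, rfl⟩)
    · exact Or.inl (Or.inr ⟨t, by omega, rfl⟩)
    · exact Or.inl (Or.inl hq)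
    · exact Or.inl (Or.inr ⟨t, by omega, rfl⟩)
    · exact Or.inr hq
    · exact Or.inl (Or.inr ⟨t, by omega, rfl⟩)

theorem succ_not_adj_succ (h : G.PathMissing x y U p m v) (hU : G.Unreached x y U) {i j : ℕ}
    (hi : i < m) (hj : j < m) (hi1 : G.Adj v (p i)) (hj1 : G.Adj v (p j)) :
    ¬ G.Adj (p (i + 1)) (p (j + 1)) := by
  wlog hij : i ≤ j generalizing i j
  · exact fun h' => this hj hi hj1 hi1 (by omega) h'.symm
  rcases hij.eq_or_lt with rfl | hij
  · exact fun h' => h'.ne rfl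
  intro h'
  -- After the reversed segment the path jumps from `p (i + 1)` straight to `p (j + 1)`.
  have := h.rotate hij hj hi1 hj1 (s := ∅) (by
    rw [Finset.empty_union, ← h.finish]
    exact h.segment hj le_rfl) h' (by simp)
  exact hU.1 (by simpa using this)

theorem succ_not_adj_of_notMem (h : G.PathMissing x y U p m v) (hU : G.Unreached x y U) {i j : ℕ}
    (hij : i ≠ j) (hi : i < m) (hj : j < m) (hi1 : G.Adj v (p i)) (hj1 : G.Adj v (p j))
    {q : V} (hq : q ∉ U) (hiq : G.Adj (p (i + 1)) q) : ¬ G.Adj (p (j + 1)) q := by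
  wlog hlt : i < j generalizing i j
  · exact fun h' => this hij.symm hj hi hj1 hi1 h' (by omega) hiq
  intro h'
  -- The same rotation, with `q` between `p (i + 1)` and `p (j + 1)`.
  have := h.rotate hlt hj hi1 hj1 (s := {q}) (by
    have := (hasPathOn_singleton q).glue h'.symm (h.segment hj le_rfl)
      (h.disjoint_segment le_rfl (by simp [hq])).symm
    rwa [h.finish] at this) hiq (by simp [hq])
  refine hU.2 q hq ?_
  rwa [Finset.insert_eq, Finset.union_comm]

/-- A chord over `p j` and an edge from `p j` to another `p (i + 1)` allow to insert `v`. -/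
theorem pred_not_adj_succ (h : G.PathMissing x y U p m v) (hU : G.Unreached x y U) {i j : ℕ}
    (hij : i ≠ j + 1) (hi : i < m) (hj : j + 1 < m) (hi1 : G.Adj v (p i))
    (hj1 : G.Adj v (p (j + 1))) (hadj : G.Adj (p (i + 1)) (p (j + 1))) :
    ¬ G.Adj (p j) (p (j + 2)) := by
  intro hchord
  have key : G.HasPathOn x y ({v, p (j + 1)} ∪ ((Finset.range (m + 1)).erase (j + 1)).image p) := by
    have hvj : G.HasPathOn v (p (j + 1)) {v, p (j + 1)} := by
      have := (hasPathOn_singleton v).glue hj1 (hasPathOn_singleton (p (j + 1)))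
        (by simpa using hj1.ne)
      rwa [← Finset.insert_eq] at this
    have hd : ∀ k l, l ≤ m → (l < j + 1 ∨ j + 1 < k) →
        Disjoint ((Finset.Icc k l).image p) {v, p (j + 1)} := by
      intro k l hl hkl
      rw [Finset.disjoint_left]
      intro q hq hq'
      obtain ⟨a, ha, rfl⟩ := Finset.mem_image.1 hq
      rw [Finset.mem_Icc] at ha
      rw [Finset.mem_insert, Finset.mem_singleton] at hq'
      rcases hq' with h' | h'
      · exact h.ne a (by omega) h'
      · have := h.inj _ (by omega) _ (by omega) h'
        omega
    rcases lt_or_gt_of_ne hij with hlt | hlt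
    · have hij' : i ≠ j := by
        rintro rfl
        exact h.not_adj_succ hU hi hi1 hj1
      -- The path `p 0, …, p i, v, p (j + 1), p (i + 1), …, p j, p (j + 2), …, p m`.
      have h1 := (((h.segment (Nat.zero_le i) hi.le).glue hi1.symm hvj
        (hd _ _ hi.le (by omega))).glue hadj.symm
        (h.segment (i := i + 1) (j := j) (by omega) (by omega)) (by
          rw [Finset.disjoint_union_left]
          exact ⟨h.disjoint_segments (by omega) (by omega) (by omega),
            (hd _ _ (by omega) (by omega)).symm⟩)).glue hchord
          (h.segment (i := j + 2) (j := m) (by omega) le_rfl) (by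
          simp only [Finset.disjoint_union_left]
          exact ⟨⟨h.disjoint_segments (by omega) (by omega) (by omega),
            (hd _ _ (by omega) (by omega)).symm⟩,
            h.disjoint_segments (by omega) (by omega) (by omega)⟩)
      rw [h.start, h.finish] at h1
      convert h1 using 1
      rw [Finset.union_right_comm (Finset.image p (Finset.Icc 0 i)),
        Finset.union_right_comm _ {v, p (j + 1)}, Finset.union_comm,
        ← Finset.image_union, ← Finset.image_union]
      congr 2
      ext t
      simp only [Finset.mem_erase, Finset.mem_range, Finset.mem_union, Finset.mem_Icc]
      omega
    -- The path `p 0, …, p j, p (j + 2), …, p i, v, p (j + 1), p (i + 1), …, p m`.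
    · have h1 := (((h.segment (Nat.zero_le j) (by omega)).glue hchord
        (h.segment (i := j + 2) (j := i) (by omega) (by omega))
        (h.disjoint_segments (by omega) (by omega) (by omega))).glue hi1.symm hvj (by
          rw [Finset.disjoint_union_left]
          exact ⟨hd _ _ (by omega) (by omega), hd _ _ (by omega) (by omega)⟩)).glue hadj.symm
          (h.segment (i := i + 1) (j := m) (by omega) le_rfl) (by
          simp only [Finset.disjoint_union_left]
          exact ⟨⟨h.disjoint_segments (by omega) (by omega) (by omega),
            h.disjoint_segments (by omega) (by omega) (by omega)⟩,
            (hd _ _ (by omega) (by omega)).symm⟩)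
      rw [h.start, h.finish] at h1
      convert h1 using 1
      rw [Finset.union_right_comm, Finset.union_comm, ← Finset.image_union, ← Finset.image_union]
      congr 2
      ext t
      simp only [Finset.mem_erase, Finset.mem_range, Finset.mem_union, Finset.mem_Icc]
      omega
  refine hU.1 ?_
  convert key using 1
  ext q
  simp only [h.mem_iff, Finset.mem_union, Finset.mem_insert, Finset.mem_singleton,
    Finset.mem_image, Finset.mem_erase, Finset.mem_range]
  constructor
  · rintro (hq | ⟨t, ht, rfl⟩)
    · exact Or.inl (Or.inl hq)
    · by_cases htj : t = j + 1
      · exact Or.inl (Or.inr (by rw [htj]))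
      · exact Or.inr ⟨t, ⟨htj, by omega⟩, rfl⟩
  · rintro ((hq | rfl) | ⟨t, ht, rfl⟩)
    · exact Or.inl hq
    · exact Or.inr ⟨j + 1, by omega, rfl⟩
    · exact Or.inr ⟨t, by omega, rfl⟩

end PathMissing

end

end SimpleGraph

/-! ### Double counting and the positions of the contacts. -/

namespace SimpleGraph

section

/-- If `e` is reflexive on `I` and the column of every related pair is at most its row,
then all these rows and columns have equal size. -/
theorem card_column_eq_card_row {I : Finset ℕ} {e : ℕ → ℕ → Prop} [DecidableRel e]
    (hr : ∀ i ∈ I, e i i)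
    (hle : ∀ i ∈ I, ∀ j ∈ I, e i j → (I.filter (e · j)).card ≤ (I.filter (e i ·)).card) :
    ∀ i ∈ I, ∀ j ∈ I, e i j → (I.filter (e · j)).card = (I.filter (e i ·)).card := by
  have hsum : ∑ j ∈ I, (I.filter (e · j)).card = ∑ i ∈ I, (I.filter (e i ·)).card :=
    (Finset.sum_card_bipartiteAbove_eq_sum_card_bipartiteBelow e).symm
  -- Rows and columns have the same total, so the diagonal inequalities are equalities. Summed over
  -- related pairs, rows and columns then both give the sum of the squared row sizes, which forces
  -- equality at each pair.
  have hdiag : ∀ i ∈ I, (I.filter (e · i)).card = (I.filter (e i ·)).card :=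
    (Finset.sum_eq_sum_iff_of_le fun i hi => hle i hi i hi (hr i hi)).1 hsum
  have hrow : ∑ i ∈ I, ∑ j ∈ I, (if e i j then (I.filter (e i ·)).card else 0)
      = ∑ i ∈ I, (I.filter (e i ·)).card * (I.filter (e i ·)).card := by
    refine Finset.sum_congr rfl fun i _ => ?_
    rw [← Finset.sum_filter, Finset.sum_const, smul_eq_mul]
  have hcol : ∑ i ∈ I, ∑ j ∈ I, (if e i j then (I.filter (e · j)).card else 0)
      = ∑ i ∈ I, (I.filter (e i ·)).card * (I.filter (e i ·)).card := by
    rw [Finset.sum_comm]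
    refine Finset.sum_congr rfl fun j hj => ?_
    rw [← Finset.sum_filter, Finset.sum_const, smul_eq_mul, hdiag j hj]
  have hterm : ∀ i ∈ I, ∀ j ∈ I, (if e i j then (I.filter (e · j)).card else 0)
      ≤ if e i j then (I.filter (e i ·)).card else 0 := by
    intro i hi j hj
    split_ifs with h
    · exact hle i hi j hj h
    · exact le_rfl
  have h1 := (Finset.sum_eq_sum_iff_of_le fun i hi =>
    Finset.sum_le_sum (hterm i hi)).1 (hcol.trans hrow.symm)
  intro i hi j hj hij
  simpa [hij] using (Finset.sum_eq_sum_iff_of_le (hterm i hi)).1 (h1 i hi) j hj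

variable {V : Type*} [Fintype V] [DecidableEq V] {G : SimpleGraph V} [DecidableRel G.Adj]

/-- The `L₁`-condition together with the existence of two common neighbours, in terms of
adjacency. -/
structure LocallyOre (G : SimpleGraph V) [DecidableRel G.Adj] : Prop where
  card_sdiff_le : ∀ u v w : V, u ≠ v → ¬ G.Adj u v → G.Adj w u → G.Adj w v →
    (G.neighborFinset w \ (G.neighborFinset u ∪ G.neighborFinset v)).card
      ≤ (G.neighborFinset u ∩ G.neighborFinset v).card + 1
  two_le : ∀ u v w : V, u ≠ v → ¬ G.Adj u v → G.Adj w u → G.Adj w v →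
    2 ≤ (G.neighborFinset u ∩ G.neighborFinset v).card

theorem LocallyOre.exists_common (hG : G.LocallyOre) {u v w : V} (hne : u ≠ v)
    (hn : ¬ G.Adj u v) (hu : G.Adj w u) (hv : G.Adj w v) :
    ∃ z, z ≠ w ∧ G.Adj u z ∧ G.Adj v z := by
  obtain ⟨z, hz, hzw⟩ := Finset.exists_mem_ne (hG.two_le u v w hne hn hu hv) w
  simp only [Finset.mem_inter, mem_neighborFinset] at hz
  exact ⟨z, hzw, hz.1, hz.2⟩

/-- The positions of the neighbours of `v` on the path. -/
def contacts (G : SimpleGraph V) [DecidableRel G.Adj] (p : ℕ → V) (m : ℕ) (v : V) : Finset ℕ :=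
  (Finset.range (m + 1)).filter fun i => G.Adj v (p i)

namespace PathMissing

variable {x y v : V} {U : Finset V} {p : ℕ → V} {m : ℕ}

omit [DecidableEq V] [Fintype V] in
theorem mem_contacts {i : ℕ} : i ∈ G.contacts p m v ↔ i ≤ m ∧ G.Adj v (p i) := by
  simp [contacts]

omit [DecidableEq V] [Fintype V] in
theorem lt_of_mem_contacts (h : G.PathMissing x y U p m v) (hy : ¬ G.Adj v y) {i : ℕ}
    (hi : i ∈ G.contacts p m v) : i < m := by
  rw [mem_contacts] at hi
  refine lt_of_le_of_ne hi.1 ?_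
  rintro rfl
  rw [h.finish] at hi
  exact hy hi.2

/-- A common neighbour outside `U` would allow inserting `v` and that vertex after `p i`. -/
theorem inter_subset (h : G.PathMissing x y U p m v) (hU : G.Unreached x y U) (hy : ¬ G.Adj v y)
    {i : ℕ} (hi : i ∈ G.contacts p m v) :
    G.neighborFinset v ∩ G.neighborFinset (p (i + 1)) ⊆
      ((G.contacts p m v).filter fun k => G.Adj (p (i + 1)) (p k)).image p := by
  intro q hq
  simp only [Finset.mem_inter, mem_neighborFinset] at hq
  by_cases hqU : q ∈ U
  · rcases (h.mem_iff q).1 hqU with rfl | ⟨t, ht, rfl⟩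
    · exact absurd hq.1 (G.loopless.irrefl _)
    · exact Finset.mem_image_of_mem _ (Finset.mem_filter.2 ⟨mem_contacts.2 ⟨ht, hq.1⟩, hq.2⟩)
  · exact absurd hq.2 (h.not_adj_of_notMem hU (h.lt_of_mem_contacts hy hi)
      (mem_contacts.1 hi).2 hqU hq.1)

theorem insert_subset (h : G.PathMissing x y U p m v) (hU : G.Unreached x y U)
    (hy : ¬ G.Adj v y) {i j : ℕ} (hi : i ∈ G.contacts p m v) (hj : j ∈ G.contacts p m v) :
    insert v (((G.contacts p m v).filter fun k => G.Adj (p (k + 1)) (p j)).image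
        fun k => p (k + 1)) ⊆
      G.neighborFinset (p j) \ (G.neighborFinset v ∪ G.neighborFinset (p (i + 1))) := by
  intro q hq
  have hi' := h.lt_of_mem_contacts hy hi
  simp only [Finset.mem_sdiff, Finset.mem_union, mem_neighborFinset]
  rcases Finset.mem_insert.1 hq with rfl | hq
  · refine ⟨(mem_contacts.1 hj).2.symm, ?_⟩
    rintro (h' | h')
    · exact G.loopless.irrefl _ h'
    · exact h.not_adj_succ hU hi' (mem_contacts.1 hi).2 h'.symm
  · obtain ⟨k, hk, rfl⟩ := Finset.mem_image.1 hq
    rw [Finset.mem_filter] at hk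
    have hk' := h.lt_of_mem_contacts hy hk.1
    refine ⟨hk.2.symm, ?_⟩
    rintro (h' | h')
    · exact h.not_adj_succ hU hk' (mem_contacts.1 hk.1).2 h'
    · exact h.succ_not_adj_succ hU hi' hk' (mem_contacts.1 hi).2 (mem_contacts.1 hk.1).2 h'

omit [Fintype V] in
theorem card_insert_image (h : G.PathMissing x y U p m v) (hy : ¬ G.Adj v y) (j : ℕ) :
    (insert v (((G.contacts p m v).filter fun k => G.Adj (p (k + 1)) (p j)).image
        fun k => p (k + 1))).card =
      ((G.contacts p m v).filter fun k => G.Adj (p (k + 1)) (p j)).card + 1 := by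
  rw [Finset.card_insert_of_notMem, Finset.card_image_of_injOn]
  · intro a ha b hb hab
    rw [Finset.mem_coe, Finset.mem_filter] at ha hb
    have := h.inj _ (h.lt_of_mem_contacts hy ha.1) _ (h.lt_of_mem_contacts hy hb.1) hab
    omega
  · intro hv
    obtain ⟨k, hk, hkv⟩ := Finset.mem_image.1 hv
    rw [Finset.mem_filter] at hk
    exact h.ne _ (h.lt_of_mem_contacts hy hk.1) hkv

omit [DecidableEq V] [Fintype V] in
theorem succ_ne (h : G.PathMissing x y U p m v) (hy : ¬ G.Adj v y) {i : ℕ}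
    (hi : i ∈ G.contacts p m v) : v ≠ p (i + 1) :=
  (h.ne _ (h.lt_of_mem_contacts hy hi)).symm

theorem card_le (h : G.PathMissing x y U p m v) (hU : G.Unreached x y U) (hG : G.LocallyOre)
    (hy : ¬ G.Adj v y) {i j : ℕ} (hi : i ∈ G.contacts p m v) (hj : j ∈ G.contacts p m v)
    (hij : G.Adj (p (i + 1)) (p j)) :
    (G.neighborFinset (p j) \ (G.neighborFinset v ∪ G.neighborFinset (p (i + 1)))).card ≤
      ((G.contacts p m v).filter fun k => G.Adj (p (i + 1)) (p k)).card + 1 := by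
  have h1 := hG.card_sdiff_le v (p (i + 1)) (p j) (h.succ_ne hy hi)
    (h.not_adj_succ hU (h.lt_of_mem_contacts hy hi) (mem_contacts.1 hi).2)
    (mem_contacts.1 hj).2.symm hij.symm
  have h2 := (Finset.card_le_card (h.inter_subset hU hy hi)).trans Finset.card_image_le
  omega

/-- By `insert_subset` and `card_le`, column `j` plus one (for `v`) is at most row `i` plus one.
Each successor is adjacent to its own contact, so the relation is reflexive and the double counting
applies. -/
theorem card_eq (h : G.PathMissing x y U p m v) (hU : G.Unreached x y U) (hG : G.LocallyOre)
    (hy : ¬ G.Adj v y) {i j : ℕ} (hi : i ∈ G.contacts p m v) (hj : j ∈ G.contacts p m v)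
    (hij : G.Adj (p (i + 1)) (p j)) :
    ((G.contacts p m v).filter fun k => G.Adj (p (k + 1)) (p j)).card =
      ((G.contacts p m v).filter fun k => G.Adj (p (i + 1)) (p k)).card := by
  refine card_column_eq_card_row (e := fun i j => G.Adj (p (i + 1)) (p j)) ?_ ?_ i hi j hj hij
  · exact fun i hi => (h.adj i (h.lt_of_mem_contacts hy hi)).symm
  · intro i hi j hj hij
    have h1 := Finset.card_le_card (h.insert_subset hU hy hi hj)
    rw [h.card_insert_image hy] at h1
    have h2 := h.card_le hU hG hy hi hj hij
    exact Nat.le_of_succ_le_succ (h1.trans h2)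

theorem two_le_card (h : G.PathMissing x y U p m v) (hU : G.Unreached x y U) (hG : G.LocallyOre)
    (hy : ¬ G.Adj v y) {i : ℕ} (hi : i ∈ G.contacts p m v) :
    2 ≤ ((G.contacts p m v).filter fun k => G.Adj (p (i + 1)) (p k)).card := by
  have h1 := hG.two_le v (p (i + 1)) (p i) (h.succ_ne hy hi)
    (h.not_adj_succ hU (h.lt_of_mem_contacts hy hi) (mem_contacts.1 hi).2)
    (mem_contacts.1 hi).2.symm (h.adj i (h.lt_of_mem_contacts hy hi))
  exact h1.trans ((Finset.card_le_card (h.inter_subset hU hy hi)).trans Finset.card_image_le)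

/-- The neighbours of a neighbour of `v` on the path. -/
theorem coverage (h : G.PathMissing x y U p m v) (hU : G.Unreached x y U) (hG : G.LocallyOre)
    (hy : ¬ G.Adj v y) {i j : ℕ} (hi : i ∈ G.contacts p m v) (hj : j ∈ G.contacts p m v)
    (hij : G.Adj (p (i + 1)) (p j)) {q : V} (hq : G.Adj (p j) q) :
    q = v ∨ G.Adj v q ∨ G.Adj (p (i + 1)) q ∨ ∃ k ∈ G.contacts p m v, p (k + 1) = q := by
  have h1 := h.card_le hU hG hy hi hj hij
  rw [← h.card_eq hU hG hy hi hj hij, ← h.card_insert_image hy] at h1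
  -- Equality of sizes leaves no room in the difference set beyond `v` and successors of contacts.
  have h2 := Finset.eq_of_subset_of_card_le (h.insert_subset hU hy hi hj) h1
  by_contra! hcon
  have h3 : q ∈ G.neighborFinset (p j) \ (G.neighborFinset v ∪ G.neighborFinset (p (i + 1))) := by
    simp [hq, hcon.2.1, hcon.2.2.1]
  rw [← h2] at h3
  rcases Finset.mem_insert.1 h3 with h4 | h4
  · exact hcon.1 h4
  · obtain ⟨k, hk, hkq⟩ := Finset.mem_image.1 h4
    exact hcon.2.2.2 k (Finset.mem_filter.1 hk).1 hkq

/-- `coverage` applied to the predecessor `p j` of a contact: the chord from `p j` to `p (j + 2)` is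
excluded by a second entry in column `j + 1`, so `p j` must itself succeed a contact. -/
theorem two_before (h : G.PathMissing x y U p m v) (hU : G.Unreached x y U) (hG : G.LocallyOre)
    (hy : ¬ G.Adj v y) {j : ℕ} (hj : j + 1 ∈ G.contacts p m v) :
    ∃ k ∈ G.contacts p m v, j + 1 = k + 2 := by
  have hj' := h.lt_of_mem_contacts hy hj
  have hself : G.Adj (p (j + 1 + 1)) (p (j + 1)) := (h.adj (j + 1) hj').symm
  rcases h.coverage hU hG hy hj hj hself (h.adj j (by omega)).symm with h1 | h1 | h1 | h1
  · exact absurd h1 (h.ne j (by omega))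
  · exact absurd (mem_contacts.1 hj).2 (h.not_adj_succ hU (by omega) h1)
  · exfalso
    have h2 := h.two_le_card hU hG hy hj
    rw [← h.card_eq hU hG hy hj hj hself] at h2
    obtain ⟨i, hi, hij⟩ := Finset.exists_mem_ne h2 (j + 1)
    rw [Finset.mem_filter] at hi
    exact h.pred_not_adj_succ hU hij (h.lt_of_mem_contacts hy hi.1) hj' (mem_contacts.1 hi.1).2
      (mem_contacts.1 hj).2 hi.2 h1.symm
  · obtain ⟨k, hk, hkj⟩ := h1
    have := h.inj _ (h.lt_of_mem_contacts hy hk) _ (by omega) hkj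
    exact ⟨k, hk, by omega⟩

theorem even_of_mem (h : G.PathMissing x y U p m v) (hU : G.Unreached x y U) (hG : G.LocallyOre)
    (hy : ¬ G.Adj v y) {j : ℕ} (hj : j ∈ G.contacts p m v) :
    Even j ∧ ∀ i, Even i → i ≤ j → i ∈ G.contacts p m v := by
  induction j using Nat.strong_induction_on with
  | _ j ih =>
    rcases j with _ | j
    · refine ⟨Even.zero, fun i _ hi => ?_⟩
      rwa [Nat.le_zero.1 hi]
    · obtain ⟨k, hk, hkj⟩ := h.two_before hU hG hy hj
      obtain ⟨h1, h2⟩ := ih k (by omega) hk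
      refine ⟨by rw [hkj]; exact h1.add even_two, fun i hi hij => ?_⟩
      rcases hij.eq_or_lt with rfl | hij
      · exact hj
      · refine h2 i hi ?_
        rw [Nat.even_iff] at *
        omega

/-- The neighbours of `v` on the path are at the even positions up to some `M`. -/
theorem exists_contacts (h : G.PathMissing x y U p m v) (hU : G.Unreached x y U)
    (hG : G.LocallyOre) (hy : ¬ G.Adj v y) (hne : (G.contacts p m v).Nonempty) :
    ∃ M, Even M ∧ 2 ≤ M ∧ M < m ∧ ∀ j, j ∈ G.contacts p m v ↔ Even j ∧ j ≤ M := by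
  have hM := Finset.max'_mem _ hne
  obtain ⟨h1, h2⟩ := h.even_of_mem hU hG hy hM
  have hiff : ∀ j, j ∈ G.contacts p m v ↔ Even j ∧ j ≤ (G.contacts p m v).max' hne :=
    fun j => ⟨fun hj => ⟨(h.even_of_mem hU hG hy hj).1, Finset.le_max' _ _ hj⟩,
      fun hj => h2 j hj.1 hj.2⟩
  refine ⟨_, h1, ?_, h.lt_of_mem_contacts hy hM, hiff⟩
  have h3 := h.two_le_card hU hG hy hM
  obtain ⟨i, hi, hi0⟩ := Finset.exists_mem_ne h3 0
  have h4 := (hiff i).1 (Finset.mem_filter.1 hi).1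
  rw [Nat.even_iff] at h4
  omega

/-- The contact `p (k + 2)` is adjacent to both `p (k + 1)` and `p (k + 3)`, so rows `k` and `k + 2`
both have the size of column `k + 2`. -/
theorem card_eq_zero (h : G.PathMissing x y U p m v) (hU : G.Unreached x y U)
    (hG : G.LocallyOre) (hy : ¬ G.Adj v y) {i : ℕ} (hi : i ∈ G.contacts p m v) :
    ((G.contacts p m v).filter fun k => G.Adj (p (i + 1)) (p k)).card =
      ((G.contacts p m v).filter fun k => G.Adj (p (0 + 1)) (p k)).card := by
  induction i using Nat.strong_induction_on with
  | _ i ih =>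
    rcases i with _ | i
    · rfl
    · obtain ⟨k, hk, hki⟩ := h.two_before hU hG hy hi
      have hk' := h.lt_of_mem_contacts hy hi
      rw [← ih k (by omega) hk, ← h.card_eq hU hG hy hi hi (h.adj _ hk').symm]
      refine h.card_eq hU hG hy hk hi ?_
      rw [hki] at hk' ⊢
      exact h.adj (k + 1) (by omega)

end PathMissing

end

end SimpleGraph

/-! ### Exchanging the missing vertex; contacts and successors are completely joined. -/

namespace SimpleGraph

section
namespace PathMissing
variable {V : Type*} {G : SimpleGraph V}
variable {x y v : V} {U : Finset V} {p : ℕ → V} {m : ℕ}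

/-- Exchange `v` with the path vertex between two neighbours of `v`. -/
theorem swap (h : G.PathMissing x y U p m v) {i : ℕ} (hi : i + 2 ≤ m) (h1 : G.Adj v (p i))
    (h2 : G.Adj v (p (i + 2))) :
    G.PathMissing x y U (Function.update p (i + 1) v) m (p (i + 1)) where
  start := by rw [Function.update_of_ne (by omega), h.start]
  finish := by rw [Function.update_of_ne (by omega), h.finish]
  inj a ha b hb hab := by
    simp only [Function.update_apply] at hab
    split_ifs at hab with h3 h4 h4
    · omega
    · exact absurd hab.symm (h.ne b hb)
    · exact absurd hab (h.ne a ha)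
    · exact h.inj a ha b hb hab
  adj a ha := by
    simp only [Function.update_apply]
    split_ifs with h3 h4 h4
    · omega
    · rw [h3]; exact h2
    · rw [show a = i by omega]; exact h1.symm
    · exact h.adj a ha
  ne a ha := by
    simp only [Function.update_apply]
    split_ifs with h3
    · exact (h.ne (i + 1) (by omega)).symm
    · exact fun h' => h3 (h.inj a ha _ (by omega) h')
  mem_iff q := by
    rw [h.mem_iff]
    constructor
    · rintro (rfl | ⟨t, ht, rfl⟩)
      · exact Or.inr ⟨i + 1, by omega, by simp⟩
      · by_cases hti : t = i + 1
        · exact Or.inl (by rw [hti])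
        · exact Or.inr ⟨t, ht, by rw [Function.update_of_ne hti]⟩
    · rintro (rfl | ⟨t, ht, rfl⟩)
      · exact Or.inr ⟨i + 1, by omega, rfl⟩
      · by_cases hti : t = i + 1
        · exact Or.inl (by rw [hti, Function.update_self])
        · exact Or.inr ⟨t, ht, by rw [Function.update_of_ne hti]⟩

/-- The path `p 0, …, p i, v, p j, p (j - 1), …, p (i + 1), p (j + 2), …, p m`,
which misses `p (j + 1)`. -/
theorem turn (h : G.PathMissing x y U p m v) {i j : ℕ} (hij : i < j) (hj : j + 2 ≤ m)
    (h1 : G.Adj v (p i)) (h2 : G.Adj v (p j)) (h3 : G.Adj (p (i + 1)) (p (j + 2))) :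
    G.PathMissing x y U
      (fun t => if t ≤ i then p t else if t = i + 1 then v else
        if t ≤ j + 1 then p (j + i + 2 - t) else p t) m (p (j + 1)) where
  start := by simpa using h.start
  finish := by
    rw [if_neg (by omega), if_neg (by omega), if_neg (by omega), h.finish]
  inj a ha b hb hab := by
    split_ifs at hab
    all_goals first
      | omega
      | exact absurd hab (h.ne _ (by omega))
      | exact absurd hab.symm (h.ne _ (by omega))
      | (have := h.inj _ (by omega) _ (by omega) hab; omega)
  adj a ha := by
    have e1 : ∀ t ≤ i, (if t ≤ i then p t else if t = i + 1 then v else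
        if t ≤ j + 1 then p (j + i + 2 - t) else p t) = p t := fun t ht => if_pos ht
    have e2 : (if i + 1 ≤ i then p (i + 1) else if i + 1 = i + 1 then v else
        if i + 1 ≤ j + 1 then p (j + i + 2 - (i + 1)) else p (i + 1)) = v := by
      rw [if_neg (by omega), if_pos rfl]
    have e3 : ∀ t, i + 1 < t → t ≤ j + 1 → (if t ≤ i then p t else if t = i + 1 then v else
        if t ≤ j + 1 then p (j + i + 2 - t) else p t) = p (j + i + 2 - t) := fun t h4 h5 => by
      rw [if_neg (by omega), if_neg (by omega), if_pos h5]
    have e4 : ∀ t, j + 1 < t → (if t ≤ i then p t else if t = i + 1 then v else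
        if t ≤ j + 1 then p (j + i + 2 - t) else p t) = p t := fun t h4 => by
      rw [if_neg (by omega), if_neg (by omega), if_neg (by omega)]
    rcases lt_trichotomy a i with hai | rfl | hai
    · rw [e1 a hai.le, e1 (a + 1) hai]
      exact h.adj a ha
    · rw [e1 a le_rfl, e2]
      exact h1.symm
    · rcases (show i + 1 ≤ a from hai).eq_or_lt with rfl | hai'
      · rw [e2, e3 (i + 1 + 1) (by omega) (by omega),
          show j + i + 2 - (i + 1 + 1) = j by omega]
        exact h2
      · rcases lt_trichotomy a (j + 1) with haj | rfl | haj
        · rw [e3 a hai' haj.le, e3 (a + 1) (by omega) haj]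
          have := h.adj (j + i + 2 - (a + 1)) (by omega)
          rw [show j + i + 2 - (a + 1) + 1 = j + i + 2 - a by omega] at this
          exact this.symm
        · rw [e3 _ hai' le_rfl, e4 (j + 1 + 1) (by omega),
            show j + i + 2 - (j + 1) = i + 1 by omega]
          exact h3
        · rw [e4 a haj, e4 (a + 1) (by omega)]
          exact h.adj a ha
  ne a ha := by
    intro hab
    split_ifs at hab
    all_goals first
      | exact h.ne _ (by omega) hab.symm
      | (have := h.inj _ (by omega) _ (by omega) hab; omega)
  mem_iff q := by
    rw [h.mem_iff]
    constructor
    · rintro (rfl | ⟨t, ht, rfl⟩)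
      · exact Or.inr ⟨i + 1, by omega, by rw [if_neg (by omega), if_pos rfl]⟩
      · rcases le_or_gt t i with hti | hti
        · exact Or.inr ⟨t, ht, if_pos hti⟩
        · rcases lt_trichotomy t (j + 1) with htj | rfl | htj
          · refine Or.inr ⟨j + i + 2 - t, by omega, ?_⟩
            rw [if_neg (by omega), if_neg (by omega), if_pos (by omega)]
            congr 1
            omega
          · exact Or.inl rfl
          · exact Or.inr ⟨t, ht, by rw [if_neg (by omega), if_neg (by omega), if_neg (by omega)]⟩
    · rintro (rfl | ⟨t, ht, rfl⟩)
      · exact Or.inr ⟨j + 1, by omega, rfl⟩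
      · split_ifs
        all_goals first
          | exact Or.inl rfl
          | exact Or.inr ⟨_, by omega, rfl⟩

variable [DecidableEq V] [Fintype V] [DecidableRel G.Adj]

/-- After the exchange `p (i + 1)` is the missing vertex for the same `U`, and `exists_contacts`
applies to it. -/
theorem exists_bound_of_swap (h : G.PathMissing x y U p m v) (hU : G.Unreached x y U)
    (hG : G.LocallyOre) {i : ℕ} (hie : Even i) (hi : i + 2 ≤ m) (h1 : G.Adj v (p i))
    (h2 : G.Adj v (p (i + 2))) (hy : ¬ G.Adj (p (i + 1)) y) :
    ∃ N, Even N ∧ i + 2 ≤ N ∧ N < m ∧ ∀ j ≤ m, Even j → (G.Adj (p (i + 1)) (p j) ↔ j ≤ N) := by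
  have hs := h.swap hi h1 h2
  have hmem : ∀ j ≤ m, j ≠ i + 1 → (j ∈ G.contacts (Function.update p (i + 1) v) m (p (i + 1)) ↔
      G.Adj (p (i + 1)) (p j)) := by
    intro j hj hji
    rw [mem_contacts, Function.update_of_ne hji]
    exact and_iff_right hj
  obtain ⟨N, hN, -, hNm, hiff⟩ := hs.exists_contacts hU hG hy
    ⟨i, (hmem i (by omega) (by omega)).2 (h.adj i (by omega)).symm⟩
  refine ⟨N, hN, ?_, hNm, fun j hj hje => ?_⟩
  · exact ((hiff (i + 2)).1 ((hmem _ hi (by omega)).2 (h.adj (i + 1) (by omega)))).2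
  · have : j ≠ i + 1 := by
      rintro rfl
      rw [Nat.even_iff] at *
      omega
    rw [← hmem j hj this, hiff]
    exact and_iff_right hje

/-- The neighbours of `v` on the path and their successors are completely joined. -/
theorem complete (h : G.PathMissing x y U p m v) (hU : G.Unreached x y U) (hG : G.LocallyOre)
    (hxy : ∀ z, G.Adj z x → ¬ G.Adj z y) (hy : ¬ G.Adj v y) {i j : ℕ}
    (hi : i ∈ G.contacts p m v) (hj : j ∈ G.contacts p m v) : G.Adj (p (i + 1)) (p j) := by
  obtain ⟨M, hM, hM2, hMm, hiff⟩ := h.exists_contacts hU hG hy ⟨i, hi⟩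
  have hv : ∀ j, Even j → j ≤ M → G.Adj v (p j) := fun j hj hjM =>
    (mem_contacts.1 ((hiff j).2 ⟨hj, hjM⟩)).2
  have hswap : ∀ i, Even i → i + 2 ≤ M → ¬ G.Adj (p (i + 1)) y →
      ∃ N, Even N ∧ i + 2 ≤ N ∧ N < m ∧ ∀ j ≤ m, Even j → (G.Adj (p (i + 1)) (p j) ↔ j ≤ N) :=
    fun i hie hiM hiy => h.exists_bound_of_swap hU hG hie (by omega) (hv _ hie (by omega))
      (hv _ (hie.add even_two) hiM) hiy
  have h10 : G.Adj (p (0 + 1)) x := by rw [← h.start]; exact (h.adj 0 (by omega)).symm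
  obtain ⟨M₀, hM₀, hM₀2, hM₀m, hiff₀⟩ := hswap 0 Even.zero (by omega) (hxy _ h10)
  have hcard := fun k (hk : k ∈ G.contacts p m v) => h.card_eq_zero hU hG hy hk
  -- If row `0` is full then all rows are, having the same size. The rest refutes `M₀ < M`.
  rcases le_or_gt M M₀ with hle | hlt
  · have hfull : (G.contacts p m v).filter (fun k => G.Adj (p (0 + 1)) (p k)) =
        G.contacts p m v := by
      refine Finset.filter_true_of_mem fun k hk => ?_
      have := (hiff k).1 hk
      exact (hiff₀ k (by omega) this.1).2 (by omega)
    have := hcard i hi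
    rw [hfull] at this
    exact Finset.card_filter_eq_iff.1 this j hj
  exfalso
  -- A row containing row `0` cannot be larger than it.
  have hno : ∀ k ∈ G.contacts p m v, ∀ l ∈ G.contacts p m v,
      (∀ j, Even j → j ≤ M₀ → G.Adj (p (k + 1)) (p j)) → M₀ < l →
      ¬ G.Adj (p (k + 1)) (p l) := by
    intro k hk l hl hsub hl0 hadj
    refine (Finset.card_lt_card ?_).ne (hcard k hk).symm
    rw [Finset.ssubset_iff_of_subset]
    · refine ⟨l, Finset.mem_filter.2 ⟨hl, hadj⟩, ?_⟩
      rw [Finset.mem_filter, hiff₀ l (mem_contacts.1 hl).1 ((hiff l).1 hl).1]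
      omega
    · intro t ht
      rw [Finset.mem_filter] at ht ⊢
      have ht' := (hiff t).1 ht.1
      exact ⟨ht.1, hsub t ht'.1 ((hiff₀ t (by omega) ht'.1).1 ht.2)⟩
  have hM₀M : M₀ + 2 ≤ M := by rw [Nat.even_iff] at *; omega
  have hbound : ∀ k, Even k → k + 2 ≤ M → ¬ G.Adj (p (k + 1)) y → k + 2 ≤ M₀ := by
    intro k hk hkM hky
    obtain ⟨N, hN, hkN, hNm, hiffN⟩ := hswap k hk hkM hky
    by_contra hcon
    refine hno k ((hiff k).2 ⟨hk, by omega⟩) (M₀ + 2) ((hiff _).2 ⟨hM₀.add even_two, hM₀M⟩)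
      (fun j hj hj0 => (hiffN j (by omega) hj).2 (by omega)) (by omega)
      ((hiffN _ (by omega) (hM₀.add even_two)).2 ?_)
    rw [Nat.even_iff] at *
    omega
  have hzy : G.Adj (p (M₀ + 1)) y := by
    by_contra hcon
    have := hbound M₀ hM₀ hM₀M hcon
    omega
  have hzx : ¬ G.Adj (p (M₀ + 1)) x := fun h' => hxy _ h' hzy
  -- Since `p (M₀ + 1)` is adjacent to `y` and not to `x`, its neighbours are counted from the `y`
  -- end. The contact `M₀ + 2` makes `m` even, and the contacts reach from there to `y`, past `M +
  -- 2`.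
  have hrev := (h.swap (i := M₀) (by omega) (hv _ hM₀ (by omega))
    (hv _ (hM₀.add even_two) hM₀M)).reverse
  have hmem : ∀ j ≤ m, j ≠ M₀ + 1 →
      (m - j ∈ G.contacts (fun t => Function.update p (M₀ + 1) v (m - t)) m (p (M₀ + 1)) ↔
        G.Adj (p (M₀ + 1)) (p j)) := by
    intro j hj hjM
    rw [mem_contacts, show m - (m - j) = j by omega, Function.update_of_ne hjM]
    exact and_iff_right (by omega)
  have hadj2 : G.Adj (p (M₀ + 1)) (p (M₀ + 2)) := h.adj (M₀ + 1) (by omega)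
  have hc2 := (hmem (M₀ + 2) (by omega) (by omega)).2 hadj2
  obtain ⟨N, hN, -, hNm, hiffN⟩ := hrev.exists_contacts hU.symm hG hzx ⟨_, hc2⟩
  have hc3 := (hiffN _).1 hc2
  have hM2m : M + 2 ≤ m := by rw [Nat.even_iff] at *; omega
  have hturn : G.Adj (p (M₀ + 1)) (p (M + 2)) := by
    rw [← hmem (M + 2) hM2m (by omega), hiffN]
    rw [Nat.even_iff] at *
    omega
  have h0mem : 0 ∈ G.contacts p m v := (hiff 0).2 ⟨Even.zero, by omega⟩
  have hMmem : M ∈ G.contacts p m v := (hiff M).2 ⟨hM, le_rfl⟩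
  -- Otherwise column `0` would lie in row `0` without its last entry `M₀`, although they have equal
  -- size.
  have hlast : G.Adj (p (M + 1)) x := by
    by_contra hcon
    refine (Finset.card_lt_card ?_).ne (h.card_eq hU hG hy h0mem h0mem (h.adj 0 (by omega)).symm)
    have hsub : ∀ k ∈ G.contacts p m v, G.Adj (p (k + 1)) (p 0) → k + 2 ≤ M₀ := by
      intro k hk hk0
      rw [h.start] at hk0
      have hk' := (hiff k).1 hk
      have hkM : k ≠ M := by
        rintro rfl
        exact hcon hk0
      refine hbound k hk'.1 ?_ (hxy _ hk0)
      rw [Nat.even_iff] at *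
      omega
    rw [Finset.ssubset_iff_of_subset]
    · refine ⟨M₀, Finset.mem_filter.2 ⟨(hiff _).2 ⟨hM₀, by omega⟩,
        (hiff₀ _ (by omega) hM₀).2 le_rfl⟩, fun h' => ?_⟩
      rw [Finset.mem_filter] at h'
      have := hsub _ h'.1 h'.2
      omega
    · intro k hk
      rw [Finset.mem_filter] at hk ⊢
      have := hsub k hk.1 hk.2
      exact ⟨hk.1, (hiff₀ k (by omega) ((hiff k).1 hk.1).1).2 (by omega)⟩
  have ht := h.turn (i := M₀) (j := M) (by omega) hM2m (hv _ hM₀ (by omega)) (hv _ hM le_rfl) hturn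
  have hmem2 : M₀ + 2 ∈ G.contacts (fun t => if t ≤ M₀ then p t else if t = M₀ + 1 then v else
        if t ≤ M + 1 then p (M + M₀ + 2 - t) else p t) m (p (M + 1)) := by
    rw [mem_contacts, if_neg (by omega), if_neg (by omega), if_pos (by omega),
      show M + M₀ + 2 - (M₀ + 2) = M by omega]
    exact ⟨by omega, (h.adj M hMm).symm⟩
  obtain ⟨N', -, -, -, hiffN'⟩ := ht.exists_contacts hU hG (hxy _ hlast) ⟨_, hmem2⟩
  -- In the turned path `p M` sits at the even position `M₀ + 2`, so the missing vertex `p (M + 1)`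
  -- is adjacent to all earlier even positions. Row `M` thus contains row `0` and also `M`.
  refine hno M hMmem M hMmem (fun j hj hj0 => ?_) hlt (h.adj M hMm).symm
  have h5 := (hiffN' j).2 ⟨hj, by have := ((hiffN' _).1 hmem2).2; omega⟩
  rw [mem_contacts, if_pos hj0] at h5
  exact h5.2

end PathMissing

end

end SimpleGraph

/-! ### Identifying a stuck graph as a member of `𝒦`. -/

namespace SimpleGraph

section
variable {V : Type*} [Fintype V] [DecidableEq V] {G : SimpleGraph V}

theorem memFamilyK_iff :
    G.MemFamilyK ↔ ∃ A : Finset V, 2 ≤ A.card ∧ Fintype.card V = 2 * A.card + 1 ∧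
      (∀ a ∈ A, ∀ b ∉ A, G.Adj a b) ∧ ∀ a ∉ A, ∀ b ∉ A, ¬ G.Adj a b := by
  constructor
  · rintro ⟨n, hn, e, h1, h2⟩
    have hmem : ∀ a, a ∈ Finset.univ.image (fun i => e.symm (Sum.inl i)) ↔
        ∃ i, e a = Sum.inl i := by
      intro a
      simp only [Finset.mem_image, Finset.mem_univ, true_and, Equiv.symm_apply_eq]
      exact exists_congr fun i => eq_comm
    have hnmem : ∀ a, a ∉ Finset.univ.image (fun i => e.symm (Sum.inl i)) →
        ∃ i, e a = Sum.inr i := by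
      intro a ha
      rw [hmem] at ha
      cases h : e a with
      | inl i => exact absurd ⟨i, h⟩ ha
      | inr i => exact ⟨i, rfl⟩
    have hcard : (Finset.univ.image (fun i : Fin n => e.symm (Sum.inl i))).card = n := by
      refine (Finset.card_image_of_injective _
        (e.symm.injective.comp Sum.inl_injective)).trans ?_
      simp
    refine ⟨Finset.univ.image (fun i => e.symm (Sum.inl i)), by omega, ?_, ?_, ?_⟩
    · rw [hcard, Fintype.card_congr e]
      simp
      omega
    · intro a ha b hb
      obtain ⟨i, hi⟩ := (hmem a).1 ha
      obtain ⟨j, hj⟩ := hnmem b hb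
      exact h1 (by simp [hi, hj])
    · intro a ha b hb hab
      obtain ⟨i, hi⟩ := hnmem a ha
      obtain ⟨j, hj⟩ := hnmem b hb
      have := h2 hab
      simp [joinGraph, completeGraph, hi, hj] at this
  · rintro ⟨A, hA, hcard, h1, h2⟩
    have c1 : Fintype.card {a // a ∈ A} = A.card := Fintype.card_coe A
    have c2 : Fintype.card {a // ¬ a ∈ A} = A.card + 1 := by
      rw [Fintype.card_subtype_compl, c1]
      omega
    refine ⟨A.card, hA, (Equiv.sumCompl (· ∈ A)).symm.trans
      (Equiv.sumCongr (Fintype.equivFinOfCardEq c1) (Fintype.equivFinOfCardEq c2)), ?_, ?_⟩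
    · intro a b hab
      by_cases ha : a ∈ A <;> by_cases hb : b ∈ A <;>
        simp [Equiv.sumCompl_symm_apply_of_pos, Equiv.sumCompl_symm_apply_of_neg, ha, hb] at hab
      · exact h1 a ha b hb
      · exact (h1 b hb a ha).symm
    · intro a b hab
      by_cases ha : a ∈ A <;> by_cases hb : b ∈ A
      · simp [joinGraph, completeGraph, Equiv.sumCompl_symm_apply_of_pos, ha, hb, hab.ne]
      · simp [joinGraph, completeGraph, Equiv.sumCompl_symm_apply_of_pos,
          Equiv.sumCompl_symm_apply_of_neg, ha, hb]
      · simp [joinGraph, completeGraph, Equiv.sumCompl_symm_apply_of_pos,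
          Equiv.sumCompl_symm_apply_of_neg, ha, hb]
      · exact absurd hab (h2 a ha b hb)

namespace PathMissing
variable {x y v : V} {U : Finset V} {p : ℕ → V} {m : ℕ} [DecidableRel G.Adj]

/-- If `q` were outside `U`, `coverage` would make it adjacent to `v` or to both `p 1` and `p 3`.
The latter is excluded by rotation; in the former case, exchanging `v` with `p 1` makes `q` adjacent
to `p 1` or `p 3` as well, and `q` can be inserted along with `v`. -/
theorem mem_of_adj_contact (h : G.PathMissing x y U p m v) (hU : G.Unreached x y U)
    (hG : G.LocallyOre) (hxy : ∀ z, G.Adj z x → ¬ G.Adj z y) (hy : ¬ G.Adj v y) {j : ℕ}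
    (hj : j ∈ G.contacts p m v) {q : V} (hq : G.Adj (p j) q) : q ∈ U := by
  by_contra hqU
  obtain ⟨M, hM, hM2, hMm, hiff⟩ := h.exists_contacts hU hG hy ⟨j, hj⟩
  have h0 : 0 ∈ G.contacts p m v := (hiff 0).2 ⟨Even.zero, by omega⟩
  have h2 : 2 ∈ G.contacts p m v := (hiff 2).2 ⟨even_two, hM2⟩
  have hv0 := (mem_contacts.1 h0).2
  have hv2 := (mem_contacts.1 h2).2
  have hcov : ∀ i ∈ G.contacts p m v, G.Adj v q ∨ G.Adj (p (i + 1)) q := by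
    intro i hi
    rcases h.coverage hU hG hy hi hj (h.complete hU hG hxy hy hi hj) hq with h3 | h3 | h3 | h3
    · exact absurd (h3 ▸ h.missing_mem) hqU
    · exact Or.inl h3
    · exact Or.inr h3
    · obtain ⟨k, hk, rfl⟩ := h3
      exact absurd (h.mem_of_le (h.lt_of_mem_contacts hy hk)) hqU
  by_cases hvq : G.Adj v q
  · have hs := h.swap (i := 0) (by omega) hv0 hv2
    have hne : ∀ k, Even k → k ≠ 0 + 1 := by
      rintro k hk rfl
      exact absurd hk (by decide)
    have hcon : ∀ k ∈ G.contacts p m v,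
        k ∈ G.contacts (Function.update p (0 + 1) v) m (p (0 + 1)) := by
      intro k hk
      rw [mem_contacts, Function.update_of_ne (hne k ((hiff k).1 hk).1)]
      exact ⟨(mem_contacts.1 hk).1, h.complete hU hG hxy hy h0 hk⟩
    have hsy : ¬ G.Adj (p (0 + 1)) y := by
      refine hxy _ ?_
      have := h.complete hU hG hxy hy h0 h0
      rwa [h.start] at this
    have hq' : G.Adj (Function.update p (0 + 1) v j) q := by
      rwa [Function.update_of_ne (hne j ((hiff j).1 hj).1)]
    rcases hs.coverage hU hG hsy (hcon 2 h2) (hcon j hj)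
      (hs.complete hU hG hxy hsy (hcon 2 h2) (hcon j hj)) hq' with h3 | h3 | h3 | h3
    · exact hqU (h3 ▸ hs.missing_mem)
    · exact h.not_adj_of_notMem hU (by omega) hv0 hqU hvq h3
    · rw [Function.update_of_ne (by omega)] at h3
      exact h.not_adj_of_notMem hU (by omega) hv2 hqU hvq h3
    · obtain ⟨k, hk, rfl⟩ := h3
      exact hqU (hs.mem_of_le (hs.lt_of_mem_contacts hsy hk))
  · exact h.succ_not_adj_of_notMem hU (show 0 ≠ 2 by omega) (by omega) (by omega) hv0 hv2 hqU
      ((hcov 0 h0).resolve_left hvq) ((hcov 2 h2).resolve_left hvq)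

/-- If the path went on to `p (M + 2)`, that vertex and `p M` would need a second common neighbour
besides `p (M + 1)`, but every candidate is excluded. -/
theorem length_eq (h : G.PathMissing x y U p m v) (hU : G.Unreached x y U)
    (hG : G.LocallyOre) (hxy : ∀ z, G.Adj z x → ¬ G.Adj z y) (hy : ¬ G.Adj v y) {M : ℕ}
    (hM : Even M) (hM2 : 2 ≤ M) (hMm : M < m)
    (hiff : ∀ j, j ∈ G.contacts p m v ↔ Even j ∧ j ≤ M) : m = M + 1 := by
  by_contra hne
  have h0 : 0 ∈ G.contacts p m v := (hiff 0).2 ⟨Even.zero, by omega⟩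
  have hMc : M ∈ G.contacts p m v := (hiff M).2 ⟨hM, le_rfl⟩
  have hadjx : ∀ i ∈ G.contacts p m v, G.Adj (p (i + 1)) x := by
    intro i hi
    have := h.complete hU hG hxy hy hi h0
    rwa [h.start] at this
  have key : ∀ k, Even k → k + 2 ≤ M → ¬ G.Adj (p (k + 1)) (p (M + 2)) := by
    intro k hk hkM hadj
    have hkc : k ∈ G.contacts p m v := (hiff k).2 ⟨hk, by omega⟩
    have hs := h.swap (i := k) (by omega) (mem_contacts.1 hkc).2
      (mem_contacts.1 ((hiff (k + 2)).2 ⟨hk.add even_two, hkM⟩)).2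
    -- In the exchanged path `v` is the successor of the contact `k`, so completeness would join it
    -- to `p (M + 2)`.
    have h1 := hs.complete hU hG hxy (hxy _ (hadjx k hkc)) (i := k) (j := M + 2)
      (mem_contacts.2 ⟨by omega, by
        rw [Function.update_of_ne (by omega)]; exact (h.adj k (by omega)).symm⟩)
      (mem_contacts.2 ⟨by omega, by rwa [Function.update_of_ne (by omega)]⟩)
    rw [Function.update_self, Function.update_of_ne (by omega)] at h1
    have := (hiff (M + 2)).1 (mem_contacts.2 ⟨by omega, h1⟩)
    omega
  have hfar : ∀ j ∈ G.contacts p m v, ∀ t, M + 2 ≤ t → t ≤ m → ¬ G.Adj (p j) (p t) := by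
    intro j hj t ht htm hadj
    rcases h.coverage hU hG hy h0 hj (h.complete hU hG hxy hy h0 hj) hadj with h3 | h3 | h3 | h3
    · exact h.ne t htm h3
    · have := (hiff t).1 (mem_contacts.2 ⟨htm, h3⟩)
      omega
    · have hs := h.swap (i := 0) (by omega) (mem_contacts.1 h0).2
        (mem_contacts.1 ((hiff 2).2 ⟨even_two, hM2⟩)).2
      have h4 := (hs.even_of_mem hU hG (hxy _ (hadjx 0 h0)) (j := t)
        (mem_contacts.2 ⟨htm, by rwa [Function.update_of_ne (by omega)]⟩)).2 (M + 2)
          (hM.add even_two) ht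
      rw [mem_contacts, Function.update_of_ne (by omega)] at h4
      exact key 0 Even.zero (by omega) h4.2
    · obtain ⟨k, hk, hkt⟩ := h3
      have := h.inj _ (h.lt_of_mem_contacts hy hk) _ htm hkt
      have := ((hiff k).1 hk).2
      omega
  obtain ⟨z, hz, hz1, hz2⟩ := hG.exists_common (u := p M) (v := p (M + 2)) (w := p (M + 1))
    (fun h' => by have := h.inj _ (by omega) _ (by omega) h'; omega)
    (hfar M hMc (M + 2) le_rfl (by omega)) (h.adj M hMm).symm (h.adj (M + 1) (by omega))
  rcases (h.mem_iff z).1 (h.mem_of_adj_contact hU hG hxy hy hMc hz1) with rfl | ⟨t, ht, rfl⟩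
  · have := (hiff (M + 2)).1 (mem_contacts.2 ⟨by omega, hz2.symm⟩)
    omega
  · rcases le_or_gt (M + 2) t with htM | htM
    · exact hfar M hMc t htM ht hz1
    · have htne : t ≠ M + 1 := fun h' => hz (by rw [h'])
      rcases Nat.even_or_odd t with hte | ⟨k, rfl⟩
      · exact hfar t ((hiff t).2 ⟨hte, by omega⟩) (M + 2) le_rfl (by omega) hz2.symm
      · refine key (2 * k) (even_two_mul k) ?_ hz2.symm
        rw [Nat.even_iff] at hM
        omega

/-- If a path that misses only `v ∈ U` cannot be extended, then `G` belongs to `𝒦`. -/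
theorem eq_univ_and_memFamilyK (h : G.PathMissing x y U p m v) (hU : G.Unreached x y U)
    (hG : G.LocallyOre) (hconn : G.Connected) (hxy : ∀ z, G.Adj z x → ¬ G.Adj z y)
    (hy : ¬ G.Adj v y) (hne : (G.contacts p m v).Nonempty) :
    U = Finset.univ ∧ G.MemFamilyK := by
  obtain ⟨M, hM, hM2, hMm, hiff⟩ := h.exists_contacts hU hG hy hne
  obtain rfl := h.length_eq hU hG hxy hy hM hM2 hMm hiff
  have h0 : 0 ∈ G.contacts p (M + 1) v := (hiff 0).2 ⟨Even.zero, by omega⟩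
  set A := (G.contacts p (M + 1) v).image p with hA
  set S := insert v ((G.contacts p (M + 1) v).image fun k => p (k + 1)) with hS
  have hAS : ∀ a ∈ A, ∀ b ∈ S, G.Adj a b := by
    intro a ha b hb
    obtain ⟨j, hj, rfl⟩ := Finset.mem_image.1 ha
    rcases Finset.mem_insert.1 hb with rfl | hb
    · exact (mem_contacts.1 hj).2.symm
    · obtain ⟨i, hi, rfl⟩ := Finset.mem_image.1 hb
      exact (h.complete hU hG hxy hy hi hj).symm
  have hSS : ∀ a ∈ S, ∀ b ∈ S, ¬ G.Adj a b := by
    intro a ha b hb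
    rcases Finset.mem_insert.1 ha with rfl | ha <;> rcases Finset.mem_insert.1 hb with rfl | hb
    · exact G.loopless.irrefl _
    · obtain ⟨i, hi, rfl⟩ := Finset.mem_image.1 hb
      exact h.not_adj_succ hU (h.lt_of_mem_contacts hy hi) (mem_contacts.1 hi).2
    · obtain ⟨i, hi, rfl⟩ := Finset.mem_image.1 ha
      exact fun h' => h.not_adj_succ hU (h.lt_of_mem_contacts hy hi) (mem_contacts.1 hi).2 h'.symm
    · obtain ⟨i, hi, rfl⟩ := Finset.mem_image.1 ha
      obtain ⟨j, hj, rfl⟩ := Finset.mem_image.1 hb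
      exact h.succ_not_adj_succ hU (h.lt_of_mem_contacts hy hi) (h.lt_of_mem_contacts hy hj)
        (mem_contacts.1 hi).2 (mem_contacts.1 hj).2
  have hSq : ∀ a ∈ S, ∀ b ∈ S, a ≠ b → ∀ q ∉ U, G.Adj a q → ¬ G.Adj b q := by
    intro a ha b hb hab q hq haq hbq
    rcases Finset.mem_insert.1 ha with rfl | ha <;> rcases Finset.mem_insert.1 hb with rfl | hb
    · exact hab rfl
    · obtain ⟨i, hi, rfl⟩ := Finset.mem_image.1 hb
      exact h.not_adj_of_notMem hU (h.lt_of_mem_contacts hy hi) (mem_contacts.1 hi).2 hq haq hbq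
    · obtain ⟨i, hi, rfl⟩ := Finset.mem_image.1 ha
      exact h.not_adj_of_notMem hU (h.lt_of_mem_contacts hy hi) (mem_contacts.1 hi).2 hq hbq haq
    · obtain ⟨i, hi, rfl⟩ := Finset.mem_image.1 ha
      obtain ⟨j, hj, rfl⟩ := Finset.mem_image.1 hb
      exact h.succ_not_adj_of_notMem hU (fun h' => hab (by rw [h']))
        (h.lt_of_mem_contacts hy hi) (h.lt_of_mem_contacts hy hj)
        (mem_contacts.1 hi).2 (mem_contacts.1 hj).2 hq haq hbq
  have hUAS : ∀ q ∈ U, q ∈ A ∨ q ∈ S := by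
    intro q hq
    rcases (h.mem_iff q).1 hq with rfl | ⟨t, ht, rfl⟩
    · exact Or.inr (Finset.mem_insert_self _ _)
    · rcases Nat.even_or_odd t with hte | ⟨k, rfl⟩
      · refine Or.inl (Finset.mem_image_of_mem _ ((hiff t).2 ⟨hte, ?_⟩))
        rw [Nat.even_iff] at *
        omega
      · exact Or.inr (Finset.mem_insert_of_mem (Finset.mem_image.2
          ⟨2 * k, (hiff _).2 ⟨even_two_mul k, by omega⟩, rfl⟩))
  have hAU : ∀ a ∈ A, ∀ q, G.Adj a q → q ∈ U := by
    intro a ha q haq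
    obtain ⟨j, hj, rfl⟩ := Finset.mem_image.1 ha
    exact h.mem_of_adj_contact hU hG hxy hy hj haq
  have hclosed : ∀ a ∈ U, ∀ q ∉ U, ¬ G.Adj a q := by
    intro a ha q hq haq
    rcases hUAS a ha with haA | haS
    · exact hq (hAU a haA q haq)
    · have h0A : p 0 ∈ A := Finset.mem_image_of_mem _ h0
      -- A second common neighbour `z` of `p 0` and `q` would lie in `S`, where two vertices share
      -- no neighbour outside `U`.
      obtain ⟨z, hz, hz1, hz2⟩ := hG.exists_common (u := p 0) (v := q) (w := a)
        (fun h' => hq (h' ▸ h.mem_of_le (Nat.zero_le _))) (fun h' => hq (hAU _ h0A q h'))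
        (hAS _ h0A a haS).symm haq
      rcases hUAS z (hAU _ h0A z hz1) with hzA | hzS
      · exact hq (hAU z hzA q hz2.symm)
      · exact hSq a haS z hzS hz.symm q hq haq hz2.symm
  have hUuniv : U = Finset.univ := by
    by_contra hcon
    obtain ⟨q, hq⟩ : ∃ q, q ∉ U := by
      by_contra! hall
      exact hcon (Finset.eq_univ_iff_forall.2 hall)
    obtain ⟨w⟩ := hconn.preconnected v q
    obtain ⟨d, -, hd1, hd2⟩ := w.exists_boundary_dart (U : Set V) h.missing_mem hq
    exact hclosed _ hd1 _ hd2 d.adj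
  refine ⟨hUuniv, memFamilyK_iff.2 ⟨A, ?_, ?_, ?_, ?_⟩⟩
  all_goals
    have hAcard : A.card = (G.contacts p (M + 1) v).card :=
      Finset.card_image_of_injOn fun a ha b hb hab =>
        h.inj a (mem_contacts.1 ha).1 b (mem_contacts.1 hb).1 hab
    have hdisj : Disjoint A S := by
      rw [Finset.disjoint_left]
      intro a ha hb
      exact G.loopless.irrefl a (hAS a ha a hb)
  · rw [hAcard]
    exact (h.two_le_card hU hG hy h0).trans (Finset.card_filter_le _ _)
  · have hScard : S.card = (G.contacts p (M + 1) v).card + 1 := by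
      have := h.card_insert_image hy 0
      rwa [Finset.filter_true_of_mem fun k hk => h.complete hU hG hxy hy hk h0] at this
    have huniv : (Finset.univ : Finset V) = A ∪ S := by
      symm
      rw [Finset.eq_univ_iff_forall]
      intro q
      exact Finset.mem_union.2 (hUAS q (hUuniv ▸ Finset.mem_univ q))
    rw [← Finset.card_univ, huniv, Finset.card_union_of_disjoint hdisj, hScard, hAcard]
    omega
  · intro a ha b hb
    exact hAS a ha b ((hUAS b (hUuniv ▸ Finset.mem_univ b)).resolve_left hb)
  · intro a ha b hb
    exact hSS a ((hUAS a (hUuniv ▸ Finset.mem_univ a)).resolve_left ha) b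
      ((hUAS b (hUuniv ▸ Finset.mem_univ b)).resolve_left hb)

end PathMissing

end

end SimpleGraph

/-! ### Translation of the hypotheses, Hamilton paths in `𝒦`, and the chain of paths. -/

namespace SimpleGraph

section
variable {V : Type*} {G : SimpleGraph V}

theorem dist_eq_two {u v w : V} (hne : u ≠ v) (hn : ¬ G.Adj u v) (hu : G.Adj w u)
    (hv : G.Adj w v) : G.dist u v = 2 := by
  have h1 : G.dist u v ≤ 2 := dist_le (Walk.cons hu.symm (Walk.cons hv Walk.nil))
  have hr : G.Reachable u v := ⟨Walk.cons hu.symm (Walk.cons hv Walk.nil)⟩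
  have h2 : G.dist u v ≠ 0 := fun h => hne (hr.dist_eq_zero_iff.1 h)
  have h3 : G.dist u v ≠ 1 := fun h => hn (dist_eq_one_iff_adj.1 h)
  omega

variable [Fintype V] [DecidableEq V]

theorem IsLGraph.locallyOre [DecidableRel G.Adj] (hL : G.IsLGraph 1)
    (hcommon : ∀ u v : V, G.dist u v = 2 →
      2 ≤ (G.neighborFinset u ∩ G.neighborFinset v).card) : G.LocallyOre where
  card_sdiff_le u v w hne hn hu hv := by
    have h1 := hL u v w (dist_eq_two hne hn hu hv) (by simp [hu.symm, hv.symm])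
    -- The degree sum is `|N(u) ∪ N(v)| + |N(u) ∩ N(v)|`; the union cancels.
    rw [← G.card_neighborFinset_eq_degree u, ← G.card_neighborFinset_eq_degree v,
      ← Finset.card_union_add_card_inter, Finset.union_comm _ (G.neighborFinset w),
      ← Finset.card_sdiff_add_card] at h1
    omega
  two_le u v w hne hn hu hv := hcommon u v (dist_eq_two hne hn hu hv)

-- No two consecutive vertices of a walk lie outside `A`; starting inside `A` saves one.
omit [Fintype V] in
theorem Walk.two_mul_countP_le {A : Finset V} (hA : ∀ a ∉ A, ∀ b ∉ A, ¬ G.Adj a b) {a b : V}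
    (w : G.Walk a b) :
    2 * w.support.countP (· ∉ A) ≤ w.support.length + 1 ∧
      (a ∈ A → 2 * w.support.countP (· ∉ A) ≤ w.support.length) := by
  induction w with
  | nil =>
    rename_i u
    by_cases hu : u ∈ A <;> simp [hu]
  | cons hadj w ih =>
    rename_i u c b
    simp only [Walk.support_cons, List.length_cons]
    by_cases hu : u ∈ A
    · rw [List.countP_cons_of_neg (by simpa using hu)]
      exact ⟨by omega, fun _ => ih.1⟩
    · have hc : c ∈ A := by
        by_contra hc
        exact hA u hu c hc hadj
      have := ih.2 hc
      rw [List.countP_cons_of_pos (by simpa using hu)]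
      exact ⟨by omega, fun h => absurd h hu⟩

/-- In a graph of the family `𝒦`, vertices without common neighbours are not joined by a
Hamilton path. -/
theorem MemFamilyK.support_ne_univ (hK : G.MemFamilyK) {x y : V}
    (hxy : ∀ z, G.Adj z x → ¬ G.Adj z y) (P : G.Walk x y) (hP : P.IsPath) :
    P.support.toFinset ≠ Finset.univ := by
  intro huniv
  obtain ⟨A, hA2, hcard, h1, h2⟩ := memFamilyK_iff.1 hK
  -- Two ends outside `A` would have every vertex of `A` as a common neighbour.
  have hend : x ∈ A ∨ y ∈ A := by
    by_contra! hcon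
    obtain ⟨a, ha⟩ : A.Nonempty := Finset.card_pos.1 (by omega)
    exact hxy a (h1 a ha x hcon.1) (h1 a ha y hcon.2)
  wlog hx : x ∈ A generalizing x y
  · exact this (fun z hzy hzx => hxy z hzx hzy) P.reverse hP.reverse
      (by simpa using huniv) hend.symm (hend.resolve_left hx)
  have hlen : P.support.length = 2 * A.card + 1 := by
    rw [← List.toFinset_card_of_nodup hP.support_nodup, huniv, Finset.card_univ, hcard]
  have hcount : P.support.countP (· ∉ A) = A.card + 1 := by
    rw [List.countP_eq_length_filter,
      ← List.toFinset_card_of_nodup (hP.support_nodup.filter _), List.toFinset_filter, huniv]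
    have h3 : Finset.univ.filter (fun a => decide (a ∉ A) = true) = Aᶜ := by
      ext
      simp
    rw [h3, Finset.card_compl]
    omega
  have := (P.two_mul_countP_le h2).2 hx
  omega

variable [DecidableRel G.Adj]

/-- A path that is not Hamiltonian is extended by one or two vertices, unless it misses just one
vertex of a graph of the family `𝒦`. -/
theorem LocallyOre.exists_extension (hG : G.LocallyOre) (hconn : G.Connected) {x y : V}
    (hxy : ∀ z, G.Adj z x → ¬ G.Adj z y) (P : G.Walk x y) (hP : P.IsPath)
    (hne : P.support.toFinset ≠ Finset.univ) :
    (∃ Q : G.Walk x y, Q.IsPath ∧ P.support.toFinset ⊂ Q.support.toFinset ∧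
      Q.support.length ≤ P.support.length + 2) ∨
      (G.MemFamilyK ∧ P.support.length + 1 = Fintype.card V) := by
  obtain ⟨w, hw⟩ : ∃ w, w ∉ P.support.toFinset := by
    by_contra! hall
    exact hne (Finset.eq_univ_iff_forall.2 hall)
  obtain ⟨W⟩ := hconn.preconnected x w
  obtain ⟨d, -, hd1, hd2⟩ :=
    W.exists_boundary_dart (P.support.toFinset : Set V) (by simp) hw
  obtain ⟨⟨u, v⟩, hadj⟩ := d
  replace hadj : G.Adj u v := hadj
  replace hd1 : u ∈ P.support.toFinset := hd1
  replace hd2 : v ∉ P.support.toFinset := hd2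
  have hPcard := List.toFinset_card_of_nodup hP.support_nodup
  have hQ : ∀ s : Finset V, P.support.toFinset ⊂ s → s.card ≤ P.support.length + 2 →
      G.HasPathOn x y s → ∃ Q : G.Walk x y, Q.IsPath ∧
        P.support.toFinset ⊂ Q.support.toFinset ∧ Q.support.length ≤ P.support.length + 2 := by
    rintro s hs hsc ⟨Q, hQ, rfl⟩
    exact ⟨Q, hQ, hs, by rwa [List.toFinset_card_of_nodup hQ.support_nodup] at hsc⟩
  have hssub := Finset.ssubset_insert hd2
  have hUcard : (insert v P.support.toFinset).card = P.support.length + 1 := by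
    rw [Finset.card_insert_of_notMem hd2, hPcard]
  by_cases hU : G.Unreached x y (insert v P.support.toFinset)
  · right
    have hpm : G.PathMissing x y (insert v P.support.toFinset) P.getVert P.length v :=
      { start := P.getVert_zero
        finish := P.getVert_length
        inj := fun i hi j hj hij => hP.getVert_injOn hi hj hij
        adj := fun i hi => P.adj_getVert_succ hi
        ne := fun i hi h' => hd2 (by
          rw [← h']
          exact List.mem_toFinset.2 (P.getVert_mem_support i))
        mem_iff := fun q => by
          rw [Finset.mem_insert, List.mem_toFinset, Walk.mem_support_iff_exists_getVert]
          exact or_congr_right (exists_congr fun i => and_comm) }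
    obtain ⟨i, hiu, hi⟩ := Walk.mem_support_iff_exists_getVert.1 (List.mem_toFinset.1 hd1)
    have hfin : insert v P.support.toFinset = Finset.univ ∧ G.MemFamilyK := by
      by_cases hy : G.Adj v y
      -- Here `v` is not adjacent to `x`, so the reversed path qualifies.
      · refine hpm.reverse.eq_univ_and_memFamilyK hU.symm hG hconn
          (fun z hzy hzx => hxy z hzx hzy) (fun hx => hxy v hx hy)
          ⟨P.length - i, PathMissing.mem_contacts.2 ⟨by omega, ?_⟩⟩
        rw [show P.length - (P.length - i) = i by omega, hiu]
        exact hadj.symm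
      · refine hpm.eq_univ_and_memFamilyK hU hG hconn hxy hy
          ⟨i, PathMissing.mem_contacts.2 ⟨hi, ?_⟩⟩
        rw [hiu]
        exact hadj.symm
    refine ⟨hfin.2, ?_⟩
    rw [← hUcard, hfin.1, Finset.card_univ]
  · left
    by_cases h1 : G.HasPathOn x y (insert v P.support.toFinset)
    · exact hQ _ hssub (by omega) h1
    · obtain ⟨q, hq, h2⟩ : ∃ q ∉ insert v P.support.toFinset,
          G.HasPathOn x y (insert q (insert v P.support.toFinset)) := by
        by_contra! hcon
        exact hU ⟨h1, hcon⟩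
      refine hQ _ (hssub.trans (Finset.ssubset_insert hq)) ?_ h2
      rw [Finset.card_insert_of_notMem hq, hUcard]

theorem LocallyOre.exists_chain (hG : G.LocallyOre) (hconn : G.Connected) {x y : V}
    (hxy : ∀ z, G.Adj z x → ¬ G.Adj z y) (P : G.Walk x y) (hP : P.IsPath) :
    ∃ (r : ℕ) (Q : Fin (r + 1) → G.Walk x y), Q 0 = P ∧
      (¬ G.MemFamilyK → (Q (Fin.last r)).support.length = Fintype.card V) ∧
      (G.MemFamilyK → (Q (Fin.last r)).support.length = Fintype.card V - 1) ∧
      (∀ i, (Q i).IsPath) ∧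
      ∀ i : Fin r, (Q i.castSucc).support.toFinset ⊂ (Q i.succ).support.toFinset ∧
        (Q i.succ).support.length ≤ (Q i.castSucc).support.length + 2 := by
  induction hk : Fintype.card V - P.support.length using Nat.strong_induction_on generalizing P with
  | _ k ih =>
    have hcard : ∀ Q : G.Walk x y, Q.IsPath → Q.support.toFinset.card = Q.support.length :=
      fun Q hQ => List.toFinset_card_of_nodup hQ.support_nodup
    by_cases huniv : P.support.toFinset = Finset.univ
    · refine ⟨0, fun _ => P, rfl, fun _ => ?_,
        fun hK => absurd huniv (hK.support_ne_univ hxy P hP), fun _ => hP, fun i => i.elim0⟩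
      rw [← hcard P hP, huniv, Finset.card_univ]
    rcases hG.exists_extension hconn hxy P hP huniv with ⟨P', hP', hsub, hle⟩ | ⟨hK, hlen⟩
    · have h1 := Finset.card_lt_card hsub
      have h2 := Finset.card_le_univ P'.support.toFinset
      rw [hcard P hP, hcard P' hP'] at h1
      rw [hcard P' hP'] at h2
      obtain ⟨r, Q, hQ0, hn, hK, hpath, hstep⟩ := ih _ (by omega) P' hP' rfl
      refine ⟨r + 1, Fin.cons P Q, rfl, ?_, ?_, ?_, ?_⟩
      · rwa [← Fin.succ_last, Fin.cons_succ]
      · rwa [← Fin.succ_last, Fin.cons_succ]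
      · exact Fin.cases hP hpath
      · refine Fin.cases ?_ fun i => ?_
        · rw [Fin.castSucc_zero, Fin.cons_zero, Fin.cons_succ, hQ0]
          exact ⟨hsub, hle⟩
        · rw [← Fin.succ_castSucc, Fin.cons_succ, Fin.cons_succ]
          exact hstep i
    · exact ⟨0, fun _ => P, rfl, fun hn => absurd hK hn, fun _ => Nat.eq_sub_of_add_eq hlen,
        fun _ => hP, fun i => i.elim0⟩

end

end SimpleGraph
theorem corollary7 {V : Type*} [Fintype V] [DecidableEq V] (G : SimpleGraph V)
    [DecidableRel G.Adj] (hconn : G.Connected) (hcard : 3 ≤ Fintype.card V)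
    (hL : G.IsLGraph 1)
    (hcommon : ∀ u v : V, G.dist u v = 2 →
      2 ≤ (G.neighborFinset u ∩ G.neighborFinset v).card)
    (x y : V) (hxy : G.neighborFinset x ∩ G.neighborFinset y = ∅) :
    ∃ (r : ℕ) (n : Fin (r + 1) → ℕ) (P : Fin (r + 1) → G.Walk x y),
      n 0 = G.dist x y + 1 ∧
      (¬ G.MemFamilyK → n (Fin.last r) = Fintype.card V) ∧
      (G.MemFamilyK → n (Fin.last r) = Fintype.card V - 1) ∧
      (∀ i : Fin r, n i.castSucc + 1 ≤ n i.succ ∧ n i.succ ≤ n i.castSucc + 2) ∧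
      (∀ i, (P i).IsPath ∧ (P i).support.length = n i) ∧
      (∀ i : Fin r, (P i.castSucc).support.toFinset ⊂ (P i.succ).support.toFinset) := by
  have hdisj : ∀ z, G.Adj z x → ¬ G.Adj z y := by
    intro z hzx hzy
    have : z ∈ G.neighborFinset x ∩ G.neighborFinset y := by simp [hzx.symm, hzy.symm]
    rw [hxy] at this
    simp at this
  obtain ⟨P, hP, hlen⟩ := hconn.exists_path_of_dist x y
  obtain ⟨r, Q, hQ0, hn, hK, hpath, hstep⟩ :=
    (hL.locallyOre hcommon).exists_chain hconn hdisj P hP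
  refine ⟨r, fun i => (Q i).support.length, Q, ?_, hn, hK, fun i => ⟨?_, (hstep i).2⟩,
    fun i => ⟨hpath i, rfl⟩, fun i => (hstep i).1⟩
  · simp only [hQ0, SimpleGraph.Walk.length_support, hlen]
  · have := Finset.card_lt_card (hstep i).1
    rwa [List.toFinset_card_of_nodup (hpath _).support_nodup,
      List.toFinset_card_of_nodup (hpath _).support_nodup] at this
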